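/- Let $n\ge 2$, let $\mathbb F$ be a field in which $2\neq 0$, and let $q\in\mathbb F^\times$. For $k\in\mathbb Z$ put $[k]=q+q^3+\dots+q^{2k-1}$ if $k\ge 0$ and $[k]=-q^{-1}-q^{-3}-\dots-q^{2k+1}$ if $k<0$. Assume that $[1],\dots,[n]$ are non-zero, and that $-1,[1],\dots,[n]$ have square roots in $\mathbb F$; fix such square roots, and put $\sqrt{[0]}=0$. Let $\mathscr H_n$ be the unital associative $\mathbb F$-algebra with generators $T_1,\dots,T_{n-1}$ and relations $(T_i-q)(T_i+q^{-1})=0$, $T_iT_j=T_jT_i$ for $|i-j|>1$, and $T_iT_{i+1}T_i=T_{i+1}T_iT_{i+1}$. For $w\in\mathfrak S_n$ with a reduced expression $w=s_{i_1}\cdots s_{i_k}$ in the simple transpositions $s_i=(i,i+1)$ put $T_w=T_{i_1}\cdots T_{i_k}$ and $\varepsilon_w=(-1)^k$. Let $\#$ be the algebra automorphism of $\mathscr H_n$ with $T_i^\#=-T_i^{-1}$ for all $i$ (so that $T_w^\#=\varepsilon_wT_{w^{-1}}^{-1}$ for all $w\in\mathfrak S_n$), let $\mathscr A_n=\{a\in\mathscr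 H_n : a^\#=a\}$ be the alternating Hecke algebra, and put $A_w=\tfrac12(T_w+\varepsilon_wT_w^\#)$, which lies in $\mathscr A_n$ if $w$ is in the alternating group $\mathfrak A_n$. For $k>0$ put $\alpha_k=\sqrt{-1}\sqrt{[k+1]}\sqrt{[k-1]}/[k]$ and $\alpha_{-k}=-\alpha_k$. Let $\lambda$ be a partition of $n$. For a standard $\lambda$-tableau $\mathfrak t$ let $c_{\mathfrak t}(i)$ be the column minus the row of the entry $i$, let $\rho_{\mathfrak t}(i)=c_{\mathfrak t}(i)-c_{\mathfrak t}(i+1)$, let $\mathfrak ts_i$ be $\mathfrak t$ with $i$ and $i+1$ exchanged, and let $\mathfrak t'$ be the conjugate (transposed) tableau. Let $S(\lambda)$ be the right $\mathscr H_n$-module with basis $\{v_{\mathfrak t}\}$ indexed by the standard $\lambda$-tableaux and with action \[ v_{\mathfrak t}T_i=\frac{-1}{[\rho_{\mathfrak t}(i)]}v_{\mathfrak t}+\alpha_{\mathfrak t}(i)v_{\mathfrak ts_i}\qquad(1\le i<n), \] where $\alpha_{\mathfrak t}(i)=\alpha_{\rho_{\mathfrak t}(i)}$ if $\mathfrak ts_i$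 is standard and $\alpha_{\mathfrak t}(i)=0$ otherwise, and let $\chi^\lambda$ be its character. Suppose now that $\lambda$ equals its conjugate partition $\lambda'$. Let $\tau$ be the linear endomorphism of $S(\lambda)$ with $\tau(v_{\mathfrak t})=v_{\mathfrak t'}$, and for $h\in\mathscr H_n$ let $\chi^\lambda(h\tau)$ be the trace on $S(\lambda)$ of the composite of $\tau$ with right multiplication by $h$. Let $S(\lambda)^\pm$ be the span of the vectors $v_{\mathfrak t}\pm v_{\mathfrak t'}$, where $\mathfrak t$ runs over the standard $\lambda$-tableaux with $2$ in the first row; it is an $\mathscr A_n$-submodule of $S(\lambda)$. Let $\chi^{\lambda\pm}_{\mathscr A}$ be its character. Then, for all $a\in\mathscr A_n$, \[ \chi^{\lambda\pm}_{\mathscr A}(a)=\tfrac12\bigl(\chi^\lambda(a)\pm\chi^\lambda(a\tau)\bigr), \] and, for all $w\in\mathfrak A_n$, \[ \chi^{\lambda\pm}_{\mathscr A}(A_w)=\tfrac12\bigl(\chi^\lambda(T_w)\pm\chi^\lambda(T_w\tau)\bigr). \] -/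

import Mathlib

namespace AltHecke

noncomputable section

variable {F : Type*} [Field F]

/-! ### The Iwahori–Hecke algebra of the symmetric group on `Fin n`

The generators `T_1, …, T_{n-1}` are indexed by `Fin (n - 1)`; the generator with index `i`
belongs to the transposition of `i` and `i + 1` in `Fin n = {0, …, n - 1}`. -/

/-- The first of the two points exchanged by the `i`-th simple transposition. -/
def lo {n : ℕ} (i : Fin (n - 1)) : Fin n := ⟨i, by omega⟩

/-- The second of the two points exchanged by the `i`-th simple transposition. -/
def hi {n : ℕ} (i : Fin (n - 1)) : Fin n := ⟨i + 1, by omega⟩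

/-- The simple transposition `s_i`. -/
def simpleTransp {n : ℕ} (i : Fin (n - 1)) : Equiv.Perm (Fin n) := Equiv.swap (lo i) (hi i)

/-- The defining relations of the Iwahori–Hecke algebra, on the free algebra. -/
inductive HeckeRel (q : Fˣ) (n : ℕ) :
    FreeAlgebra F (Fin (n - 1)) → FreeAlgebra F (Fin (n - 1)) → Prop
  | quad (i : Fin (n - 1)) : HeckeRel q n
      ((FreeAlgebra.ι F i - algebraMap F _ (q : F)) *
        (FreeAlgebra.ι F i + algebraMap F _ ((q : F)⁻¹))) 0
  | comm (i j : Fin (n - 1)) (h : (i : ℕ) + 1 < j) : HeckeRel q n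
      (FreeAlgebra.ι F i * FreeAlgebra.ι F j) (FreeAlgebra.ι F j * FreeAlgebra.ι F i)
  | braid (i j : Fin (n - 1)) (h : (j : ℕ) = i + 1) : HeckeRel q n
      (FreeAlgebra.ι F i * FreeAlgebra.ι F j * FreeAlgebra.ι F i)
      (FreeAlgebra.ι F j * FreeAlgebra.ι F i * FreeAlgebra.ι F j)

/-- The Iwahori–Hecke algebra of type `A_{n-1}` with parameter `q`. -/
def Hecke (q : Fˣ) (n : ℕ) : Type _ := RingQuot (HeckeRel q n)

instance (q : Fˣ) (n : ℕ) : Ring (Hecke q n) := inferInstanceAs (Ring (RingQuot (HeckeRel q n)))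

instance (q : Fˣ) (n : ℕ) : Algebra F (Hecke q n) :=
  inferInstanceAs (Algebra F (RingQuot (HeckeRel q n)))

/-- The canonical surjection from the free algebra. -/
def heckeMk (q : Fˣ) (n : ℕ) : FreeAlgebra F (Fin (n - 1)) →ₐ[F] Hecke q n :=
  RingQuot.mkAlgHom F (HeckeRel q n)

lemma heckeMk_rel {q : Fˣ} {n : ℕ} {x y : FreeAlgebra F (Fin (n - 1))} (h : HeckeRel q n x y) :
    heckeMk q n x = heckeMk q n y :=
  RingQuot.mkAlgHom_rel F h

/-- The generator `T_i`. -/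
def heckeGen (q : Fˣ) (n : ℕ) (i : Fin (n - 1)) : Hecke q n :=
  heckeMk q n (FreeAlgebra.ι F i)

/-- The universal property of the presentation. -/
def heckeLift (q : Fˣ) (n : ℕ) {B : Type*} [Ring B] [Algebra F B] (f : Fin (n - 1) → B)
    (hquad : ∀ i, (f i - algebraMap F B (q : F)) * (f i + algebraMap F B ((q : F)⁻¹)) = 0)
    (hcomm : ∀ i j : Fin (n - 1), (i : ℕ) + 1 < j → f i * f j = f j * f i)
    (hbraid : ∀ i j : Fin (n - 1), (j : ℕ) = i + 1 → f i * f j * f i = f j * f i * f j) :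
    Hecke q n →ₐ[F] B :=
  RingQuot.liftAlgHom F ⟨FreeAlgebra.lift F f, by
    intro x y h
    cases h with
    | quad i => simpa using hquad i
    | comm i j h => simpa using hcomm i j h
    | braid i j h => simpa using hbraid i j h⟩

@[simp] lemma heckeLift_gen (q : Fˣ) (n : ℕ) {B : Type*} [Ring B] [Algebra F B]
    (f : Fin (n - 1) → B) (h₁) (h₂) (h₃) (i : Fin (n - 1)) :
    heckeLift q n f h₁ h₂ h₃ (heckeGen q n i) = f i := by
  exact (RingQuot.liftAlgHom_mkAlgHom_apply F _ _ _).trans (FreeAlgebra.lift_ι_apply _ _)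

lemma heckeGen_quad (q : Fˣ) (n : ℕ) (i : Fin (n - 1)) :
    (heckeGen q n i - algebraMap F _ (q : F)) *
      (heckeGen q n i + algebraMap F _ ((q : F)⁻¹)) = 0 := by
  simpa [heckeGen] using heckeMk_rel (HeckeRel.quad (q := q) (n := n) i)

lemma heckeGen_comm (q : Fˣ) (n : ℕ) (i j : Fin (n - 1)) (h : (i : ℕ) + 1 < j) :
    heckeGen q n i * heckeGen q n j = heckeGen q n j * heckeGen q n i := by
  simpa [heckeGen] using heckeMk_rel (HeckeRel.comm (q := q) (n := n) i j h)

lemma heckeGen_braid (q : Fˣ) (n : ℕ) (i j : Fin (n - 1)) (h : (j : ℕ) = i + 1) :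
    heckeGen q n i * heckeGen q n j * heckeGen q n i =
      heckeGen q n j * heckeGen q n i * heckeGen q n j := by
  simpa [heckeGen] using heckeMk_rel (HeckeRel.braid (q := q) (n := n) i j h)

lemma hecke_hom_ext {q : Fˣ} {n : ℕ} {B : Type*} [Ring B] [Algebra F B]
    {f g : Hecke q n →ₐ[F] B} (h : ∀ i, f (heckeGen q n i) = g (heckeGen q n i)) : f = g := by
  refine RingQuot.ringQuot_ext' F f g (FreeAlgebra.hom_ext ?_)
  funext i
  exact h i

/-- Every element of the Hecke algebra is built from the generators. -/
lemma hecke_induction {q : Fˣ} {n : ℕ} {P : Hecke q n → Prop}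
    (hscalar : ∀ c : F, P (algebraMap F _ c)) (hgen : ∀ i, P (heckeGen q n i))
    (hadd : ∀ x y, P x → P y → P (x + y)) (hmul : ∀ x y, P x → P y → P (x * y))
    (x : Hecke q n) : P x := by
  obtain ⟨y, rfl⟩ : ∃ y, heckeMk q n y = x := RingQuot.mkAlgHom_surjective F (HeckeRel q n) x
  induction y using FreeAlgebra.induction with
  | grade0 r => simpa using hscalar r
  | grade1 i => exact hgen i
  | mul a b ha hb => rw [map_mul]; exact hmul _ _ ha hb
  | add a b ha hb => rw [map_add]; exact hadd _ _ ha hb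

/-- The inverse `T_i⁻¹ = T_i - q + q⁻¹`. -/
def heckeGenInv (q : Fˣ) (n : ℕ) (i : Fin (n - 1)) : Hecke q n :=
  heckeGen q n i - algebraMap F _ ((q : F) - (q : F)⁻¹)

lemma heckeGen_sq (q : Fˣ) (n : ℕ) (i : Fin (n - 1)) :
    heckeGen q n i * heckeGen q n i =
      ((q : F) - (q : F)⁻¹) • heckeGen q n i + 1 := by
  have h := heckeGen_quad q n i
  have hq : (q : F) * (q : F)⁻¹ = 1 := mul_inv_cancel₀ q.ne_zero
  simp only [Algebra.algebraMap_eq_smul_one, sub_mul, mul_add, mul_smul_comm, smul_mul_assoc,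
    mul_one, one_mul] at h
  rw [← sub_eq_zero, ← h]
  match_scalars <;> simp
  ring

lemma heckeGen_mul_inv (q : Fˣ) (n : ℕ) (i : Fin (n - 1)) :
    heckeGen q n i * heckeGenInv q n i = 1 := by
  rw [heckeGenInv, mul_sub, heckeGen_sq, Algebra.algebraMap_eq_smul_one, mul_smul_comm, mul_one]
  abel

lemma heckeGen_inv_mul (q : Fˣ) (n : ℕ) (i : Fin (n - 1)) :
    heckeGenInv q n i * heckeGen q n i = 1 := by
  rw [heckeGenInv, sub_mul, heckeGen_sq, Algebra.algebraMap_eq_smul_one, smul_mul_assoc, one_mul]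
  abel

/-- `T_i` as a unit of the Hecke algebra. -/
def heckeUnit (q : Fˣ) (n : ℕ) (i : Fin (n - 1)) : (Hecke q n)ˣ :=
  ⟨heckeGen q n i, heckeGenInv q n i, heckeGen_mul_inv q n i, heckeGen_inv_mul q n i⟩

/-- The algebra endomorphism `#` of the Hecke algebra with `T_i^# = -T_i⁻¹` for all `i`; it is the
unique algebra endomorphism with `T_x^# = (-1)^{ℓ(x)} (T_{x⁻¹})⁻¹` for every permutation `x`. -/
def hash (q : Fˣ) (n : ℕ) : Hecke q n →ₐ[F] Hecke q n :=
  heckeLift q n (fun i => -heckeGenInv q n i)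
    (by
      intro i
      have hq : (q : F) * (q : F)⁻¹ = 1 := mul_inv_cancel₀ q.ne_zero
      simp only [heckeGenInv, Algebra.algebraMap_eq_smul_one, neg_sub, sub_mul, mul_add, mul_sub,
        mul_smul_comm, smul_mul_assoc, mul_one, one_mul, heckeGen_sq]
      match_scalars
      · linear_combination -hq
      · ring)
    (by
      intro i j h
      have : Commute (heckeUnit q n i) (heckeUnit q n j) :=
        Units.ext (heckeGen_comm q n i j h)
      have := congrArg Units.val (this.inv_inv).eq
      simpa [heckeUnit] using this)
    (by
      intro i j h
      have h1 : heckeUnit q n i * heckeUnit q n j * heckeUnit q n i =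
          heckeUnit q n j * heckeUnit q n i * heckeUnit q n j :=
        Units.ext (heckeGen_braid q n i j h)
      have h2 := congrArg (fun u : (Hecke q n)ˣ => ((u⁻¹ : (Hecke q n)ˣ) : Hecke q n)) h1
      simpa [heckeUnit, mul_assoc] using h2)

@[simp] lemma hash_gen (q : Fˣ) (n : ℕ) (i : Fin (n - 1)) :
    hash q n (heckeGen q n i) = -heckeGenInv q n i := by
  simp [hash]

@[simp] lemma hash_hash (q : Fˣ) (n : ℕ) (h : Hecke q n) : hash q n (hash q n h) = h := by
  have : (hash q n).comp (hash q n) = AlgHom.id F _ := by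
    apply hecke_hom_ext
    intro i
    simp [heckeGenInv]
  exact DFunLike.congr_fun this h

/-- The alternating Hecke algebra: the fixed-point subalgebra of `#`. -/
def altHecke (q : Fˣ) (n : ℕ) : Subalgebra F (Hecke q n) :=
  AlgHom.equalizer (hash q n) (AlgHom.id F (Hecke q n))

lemma mem_altHecke {q : Fˣ} {n : ℕ} {a : Hecke q n} : a ∈ altHecke q n ↔ hash q n a = a :=
  Iff.rfl

/-! ### Reduced expressions, and the elements `T_w` and `A_w` -/

/-- A reduced expression `w = s_{i_1} ⋯ s_{i_k}`: a word of minimal length in the simple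
transpositions with product `w`. -/
structure ReducedExpr {n : ℕ} (w : Equiv.Perm (Fin n)) where
  /-- The word `(i_1, …, i_k)`. -/
  word : List (Fin (n - 1))
  prod_eq : (word.map simpleTransp).prod = w
  minimal : ∀ l : List (Fin (n - 1)), (l.map simpleTransp).prod = w → word.length ≤ l.length

/-- The simple transpositions generate the symmetric group. -/
lemma exists_word {n : ℕ} (w : Equiv.Perm (Fin n)) :
    ∃ l : List (Fin (n - 1)), (l.map simpleTransp).prod = w := by
  cases n with
  | zero => exact ⟨[], Subsingleton.elim _ _⟩
  | succ m =>
    have hw : w ∈ Submonoid.closure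
        (Set.range fun i : Fin m => Equiv.swap i.castSucc i.succ) := by
      rw [Equiv.Perm.mclosure_swap_castSucc_succ]; trivial
    induction hw using Submonoid.closure_induction with
    | mem x hx =>
      obtain ⟨i, rfl⟩ := hx
      exact ⟨[i], by simp [simpleTransp, lo, hi]; rfl⟩
    | one => exact ⟨[], rfl⟩
    | mul x y _ _ hx hy =>
      obtain ⟨l, rfl⟩ := hx
      obtain ⟨l', rfl⟩ := hy
      exact ⟨l ++ l', by simp⟩

/-- Every permutation has a reduced expression. -/
instance {n : ℕ} (w : Equiv.Perm (Fin n)) : Nonempty (ReducedExpr w) := by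
  obtain ⟨l, hl, hmin⟩ := exists_minimal_of_wellFoundedLT
    (fun k : ℕ => ∃ l : List (Fin (n - 1)), l.length = k ∧ (l.map simpleTransp).prod = w)
    (by obtain ⟨l, hl⟩ := exists_word w; exact ⟨_, l, rfl, hl⟩)
  obtain ⟨l, rfl, hl⟩ := hl
  refine ⟨⟨l, hl, fun l' hl' => ?_⟩⟩
  by_contra h
  exact h (hmin ⟨l', rfl, hl'⟩ (by omega))

/-- `T_w = T_{i_1} ⋯ T_{i_k}` for a reduced expression `w = s_{i_1} ⋯ s_{i_k}`. -/
def heckeT (q : Fˣ) {n : ℕ} {w : Equiv.Perm (Fin n)} (e : ReducedExpr w) : Hecke q n :=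
  (e.word.map (heckeGen q n)).prod

/-- `A_w = ½ (T_w + (-1)^{ℓ(w)} T_w^#)`. -/
def heckeA (q : Fˣ) {n : ℕ} {w : Equiv.Perm (Fin n)} (e : ReducedExpr w) : Hecke q n :=
  (2 : F)⁻¹ • (heckeT q e + (-1 : F) ^ e.word.length • hash q n (heckeT q e))

lemma sign_word {n : ℕ} (l : List (Fin (n - 1))) :
    Equiv.Perm.sign (l.map simpleTransp).prod = (-1) ^ l.length := by
  induction l with
  | nil => simp
  | cons i l ih =>
    have : lo i ≠ hi i := by simp [lo, hi, Fin.ext_iff]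
    simp [ih, simpleTransp, Equiv.Perm.sign_swap this, pow_succ]

lemma heckeA_mem (q : Fˣ) {n : ℕ} (w : alternatingGroup (Fin n))
    (e : ReducedExpr (w : Equiv.Perm (Fin n))) : heckeA q e ∈ altHecke q n := by
  have h : Even e.word.length := by
    have h1 := sign_word e.word
    rw [e.prod_eq, Equiv.Perm.mem_alternatingGroup.mp w.2] at h1
    by_contra hodd
    rw [(Nat.not_even_iff_odd.mp hodd).neg_one_pow] at h1
    exact absurd h1 (by decide)
  rw [mem_altHecke, heckeA, h.neg_one_pow, one_smul, map_smul, map_add, hash_hash, add_comm]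

/-- `A_w`, for an even permutation `w`, as an element of the alternating Hecke algebra. -/
def altA (q : Fˣ) {n : ℕ} (w : alternatingGroup (Fin n))
    (e : ReducedExpr (w : Equiv.Perm (Fin n))) : altHecke q n :=
  ⟨heckeA q e, heckeA_mem q w e⟩

/-! ### Quantum integers and the choice of square roots -/

/-- The quantum integer `[k]`: `q + q³ + ⋯ + q^{2k-1}` for `k ≥ 0` and
`-q⁻¹ - q⁻³ - ⋯ - q^{2k+1}` for `k < 0`. -/
def qInt (q : Fˣ) : ℤ → F
  | Int.ofNat k => ∑ j ∈ Finset.range k, (q : F) ^ (2 * j + 1)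
  | Int.negSucc k => -∑ j ∈ Finset.range (k + 1), ((q : F)⁻¹) ^ (2 * j + 1)

lemma qInt_zero (q : Fˣ) : qInt q 0 = 0 := by
  change ∑ j ∈ Finset.range 0, (q : F) ^ (2 * j + 1) = 0
  simp

lemma qInt_succ (q : Fˣ) (k : ℤ) : qInt q (k + 1) = qInt q k + (q : F) ^ (2 * k + 1) := by
  rcases k with k | k
  · change ∑ j ∈ Finset.range (k + 1), (q : F) ^ (2 * j + 1) = _
    rw [Finset.sum_range_succ]
    congr 1
    exact (zpow_natCast (q : F) (2 * k + 1)).symm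
  · cases k with
    | zero =>
      change ∑ j ∈ Finset.range 0, (q : F) ^ (2 * j + 1) = -∑ j ∈ Finset.range (0 + 1), _ + _
      simp
    | succ k =>
      change -∑ j ∈ Finset.range (k + 1), ((q : F)⁻¹) ^ (2 * j + 1) =
        -∑ j ∈ Finset.range (k + 1 + 1), ((q : F)⁻¹) ^ (2 * j + 1) + _
      rw [Finset.sum_range_succ _ (k + 1)]
      have : (q : F) ^ (2 * Int.negSucc (k + 1) + 1) = ((q : F)⁻¹) ^ (2 * (k + 1) + 1) := by
        rw [inv_pow, ← zpow_natCast, ← zpow_neg]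
        congr 1
      rw [this]
      ring

lemma qInt_mul (q : Fˣ) (k : ℤ) :
    1 + ((q : F) - (q : F)⁻¹) * qInt q k = (q : F) ^ (2 * k) := by
  have hq : (q : F) ≠ 0 := q.ne_zero
  induction k using Int.induction_on with
  | zero => simp [qInt_zero]
  | succ k ih =>
    rw [qInt_succ, mul_add, ← add_assoc, ih, mul_add 2, zpow_add₀ hq, zpow_add₀ hq]
    field_simp
    simp [zpow_ofNat]
  | pred k ih =>
    have h := qInt_succ q (-(k : ℤ) - 1)
    rw [sub_add_cancel] at h
    rw [h] at ih
    have e1 : (q : F) ^ (2 * (-(k : ℤ) - 1) + 1) = (q : F) ^ (2 * -(k : ℤ)) * (q : F)⁻¹ := by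
      rw [← zpow_neg_one, ← zpow_add₀ hq]; congr 1; ring
    have e2 : (q : F) ^ (2 * (-(k : ℤ) - 1)) = (q : F) ^ (2 * -(k : ℤ)) * ((q : F)⁻¹ * (q : F)⁻¹) := by
      rw [← zpow_neg_one, ← zpow_add₀ hq, ← zpow_add₀ hq]; congr 1; ring
    rw [e1] at ih
    rw [e2]
    have hqq : (q : F) * (q : F)⁻¹ = 1 := mul_inv_cancel₀ hq
    linear_combination ih - (q : F) ^ (2 * -(k : ℤ)) * hqq

lemma qInt_add (q : Fˣ) (k l : ℤ) :
    qInt q (k + l) = qInt q k + (q : F) ^ (2 * k) * qInt q l := by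
  have hq : (q : F) ≠ 0 := q.ne_zero
  induction l using Int.induction_on with
  | zero => simp [qInt_zero]
  | succ l ih =>
    rw [← add_assoc, qInt_succ, qInt_succ, ih, mul_add (_ ^ _), ← zpow_add₀ hq, ← add_assoc]
    congr 2
    ring
  | pred l ih =>
    have h1 := qInt_succ q (k + (-(l : ℤ) - 1))
    have h2 := qInt_succ q (-(l : ℤ) - 1)
    rw [sub_add_cancel] at h2
    rw [show k + (-(l : ℤ) - 1) + 1 = k + -(l : ℤ) by ring, ih, h2, mul_add, ← zpow_add₀ hq,
      show 2 * k + (2 * (-(l : ℤ) - 1) + 1) = 2 * (k + (-(l : ℤ) - 1)) + 1 by ring] at h1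
    linear_combination -h1

lemma qInt_neg (q : Fˣ) (k : ℤ) : (q : F) ^ (2 * k) * qInt q (-k) = -qInt q k := by
  have h := qInt_add q k (-k)
  rw [add_neg_cancel, qInt_zero] at h
  linear_combination -h

/-- The standing assumptions on the ground field: `[1], …, [n]` are non-zero, and square roots of
`-1` and of `[1], …, [n]` in the field are fixed (the case `k = 0` says that `√[0] = 0`). -/
structure SquareRoots (q : Fˣ) (n : ℕ) where
  qInt_ne_zero : ∀ k : ℕ, 1 ≤ k → k ≤ n → qInt q k ≠ 0
  /-- `√-1` -/
  sqrtNegOne : F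
  sqrtNegOne_sq : sqrtNegOne ^ 2 = -1
  /-- `√[k]` -/
  sqrtQInt : ℕ → F
  sqrtQInt_sq : ∀ k : ℕ, k ≤ n → sqrtQInt k ^ 2 = qInt q k

variable {q : Fˣ} {n : ℕ}

/-- `√-1 √[k+1] √[k-1] / [k]` for `k > 0`. -/
def alphaPos (S : SquareRoots q n) (k : ℕ) : F :=
  S.sqrtNegOne * S.sqrtQInt (k + 1) * S.sqrtQInt (k - 1) / qInt q k

/-- The coefficients `α_k`, for `k ≠ 0`, with `α_{-k} = -α_k`. -/
def alpha (S : SquareRoots q n) (k : ℤ) : F :=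
  if 0 < k then alphaPos S k.natAbs else if k < 0 then -alphaPos S k.natAbs else 0

lemma alpha_neg (S : SquareRoots q n) (k : ℤ) : alpha S (-k) = -alpha S k := by
  rcases lt_trichotomy k 0 with h | h | h
  · simp [alpha, h, h.not_gt]
  · simp [alpha, h]
  · simp [alpha, h, h.not_gt]

lemma alpha_of_natAbs_eq_one (S : SquareRoots q n) {k : ℤ} (h : k.natAbs = 1) :
    alpha S k = 0 := by
  have h0 : S.sqrtQInt 0 = 0 := by
    have := S.sqrtQInt_sq 0 (Nat.zero_le _)
    rw [Nat.cast_zero, qInt_zero] at this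
    exact pow_eq_zero_iff (two_ne_zero) |>.mp this
  simp [alpha, alphaPos, h, h0]

lemma qInt_ne_zero (S : SquareRoots q n) {k : ℤ} (h0 : k ≠ 0) (hk : k.natAbs ≤ n) :
    qInt q k ≠ 0 := by
  have h1 := S.qInt_ne_zero k.natAbs (by omega) hk
  rcases Int.natAbs_eq k with h | h
  · rwa [← h] at h1
  · intro hz
    have h2 := qInt_neg q k
    rw [hz, neg_zero] at h2
    have : -k = (k.natAbs : ℤ) := by omega
    rw [this] at h2
    exact (mul_ne_zero (zpow_ne_zero _ q.ne_zero) h1) h2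

lemma alpha_mul_alpha_neg (S : SquareRoots q n) {k : ℤ} (h0 : k ≠ 0) (hk : k.natAbs < n) :
    alpha S k * alpha S (-k) = 1 - (q : F) ^ (2 * k) / qInt q k ^ 2 := by
  have hq : (q : F) ≠ 0 := q.ne_zero
  -- it suffices to treat positive `k`
  have key : ∀ m : ℕ, 1 ≤ m → m < n →
      -(alphaPos S m) ^ 2 = 1 - (q : F) ^ (2 * (m : ℤ)) / qInt q (m : ℤ) ^ 2 := by
    intro m hm hmn
    have hne := S.qInt_ne_zero m hm hmn.le
    have e1 := S.sqrtQInt_sq (m + 1) hmn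
    have e2 := S.sqrtQInt_sq (m - 1) (by omega)
    have e3 := S.sqrtNegOne_sq
    have e4 := qInt_succ q (m : ℤ)
    have e5 := qInt_succ q ((m : ℤ) - 1)
    have e6 := qInt_mul q (m : ℤ)
    rw [sub_add_cancel] at e5
    have c1 : (((m + 1 : ℕ)) : ℤ) = (m : ℤ) + 1 := by push_cast; ring
    have c2 : (((m - 1 : ℕ)) : ℤ) = (m : ℤ) - 1 := by omega
    rw [c1, e4] at e1
    rw [c2] at e2
    have z1 : (q : F) ^ (2 * (m : ℤ) + 1) = (q : F) ^ (2 * (m : ℤ)) * q := zpow_add_one₀ hq _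
    have z2 : (q : F) ^ (2 * ((m : ℤ) - 1) + 1) = (q : F) ^ (2 * (m : ℤ)) * (q : F)⁻¹ := by
      rw [← zpow_sub_one₀ hq]; congr 1; ring
    rw [z1] at e1
    rw [z2] at e5
    rw [alphaPos, div_pow, mul_pow, mul_pow, e1, e2, e3]
    have hqq : (q : F) * (q : F)⁻¹ = 1 := mul_inv_cancel₀ hq
    generalize (q : F) ^ (2 * (m : ℤ)) = X at *
    generalize qInt q ((m : ℤ) - 1) = v at *
    generalize qInt q (m : ℤ) = u at *
    rw [← neg_div, eq_sub_iff_add_eq, ← add_div, div_eq_one_iff_eq (pow_ne_zero 2 hne)]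
    have hv : v = u - X * (q : F)⁻¹ := by linear_combination -e5
    rw [hv]
    linear_combination X * e6 - X ^ 2 * hqq
  rw [alpha_neg]
  rcases lt_or_gt_of_ne h0 with h | h
  · have hk' := key k.natAbs (by omega) hk
    have hc : ((k.natAbs : ℕ) : ℤ) = -k := by omega
    rw [hc] at hk'
    have hn := qInt_neg q k
    have hn1 := qInt_ne_zero S h0 hk.le
    have hX : (q : F) ^ (2 * k) ≠ 0 := zpow_ne_zero _ hq
    have hXi : (q : F) ^ (2 * -k) = ((q : F) ^ (2 * k))⁻¹ := by rw [mul_neg, zpow_neg]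
    have hn2 : qInt q (-k) = -qInt q k / (q : F) ^ (2 * k) := by
      rw [eq_div_iff hX, mul_comm, hn]
    rw [hXi, hn2] at hk'
    have ha : alpha S k = -alphaPos S k.natAbs := by simp [alpha, h, h.not_gt]
    rw [ha]
    have : -alphaPos S k.natAbs * - -alphaPos S k.natAbs = -(alphaPos S k.natAbs) ^ 2 := by ring
    rw [this, hk']
    field_simp
  · have hk' := key k.natAbs (by omega) hk
    have hc : ((k.natAbs : ℕ) : ℤ) = k := by omega
    rw [hc] at hk'
    have ha : alpha S k = alphaPos S k.natAbs := by simp [alpha, h]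
    rw [ha, ← hk']
    ring

/-! ### Standard tableaux -/

/-- The diagram `lam` filled bijectively with the numbers `1, …, n`; the number `k + 1` is encoded
as `k : Fin n`. A cell `(r, c)` lies in row `r` and column `c`, both counted from `0`. -/
abbrev Tableau (lam : YoungDiagram) (n : ℕ) : Type := lam.cells ≃ Fin n

variable {lam mu : YoungDiagram}

/-- The entries increase along rows and down columns. -/
def IsStandard (t : Tableau lam n) : Prop :=
  ∀ x y : lam.cells, x ≠ y → x.1.1 ≤ y.1.1 → x.1.2 ≤ y.1.2 → t x < t y

/-- The set of standard `lam`-tableaux. -/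
abbrev StdTableau (lam : YoungDiagram) (n : ℕ) : Type := {t : Tableau lam n // IsStandard t}

/-- The content (column minus row) of an entry. -/
def content (t : Tableau lam n) (k : Fin n) : ℤ :=
  ((t.symm k).1.2 : ℤ) - ((t.symm k).1.1 : ℤ)

/-- The axial distance `c_t(i) - c_t(i+1)`. -/
def axialDist (t : Tableau lam n) (i : Fin (n - 1)) : ℤ := content t (lo i) - content t (hi i)

/-- The tableau `t s_i`, in which the entries `i` and `i + 1` are exchanged. -/
def tabSwap (t : Tableau lam n) (i : Fin (n - 1)) : Tableau lam n := t.trans (simpleTransp i)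

/-- The cells of a diagram and those of its transpose. -/
def cellSwap (h : lam.transpose = mu) : mu.cells ≃ lam.cells where
  toFun x := ⟨x.1.swap, by
    have h' : ∀ c ∈ mu, c.swap ∈ lam := fun c hc => by
      rwa [← h, YoungDiagram.mem_transpose] at hc
    exact h' _ x.2⟩
  invFun x := ⟨x.1.swap, by
    rw [YoungDiagram.mem_cells, ← h, YoungDiagram.mem_transpose, Prod.swap_swap]
    exact x.2⟩
  left_inv x := by simp
  right_inv x := by simp

/-- The conjugate tableau `t'`, with `t'(c, r) = t(r, c)`. -/
def conjTab (h : lam.transpose = mu) (t : Tableau lam n) : Tableau mu n := (cellSwap h).trans t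

lemma IsStandard.conj (h : lam.transpose = mu) {t : Tableau lam n} (ht : IsStandard t) :
    IsStandard (conjTab h t) := by
  intro x y hxy h1 h2
  exact ht _ _ (fun e => hxy ((cellSwap h).injective e)) h2 h1

/-- The conjugate of a standard tableau. -/
def conjStd (h : lam.transpose = mu) (t : StdTableau lam n) : StdTableau mu n :=
  ⟨conjTab h t.1, t.2.conj h⟩

lemma lo_ne_hi (i : Fin (n - 1)) : lo i ≠ hi i := by simp [lo, hi, Fin.ext_iff]

lemma content_tabSwap (t : Tableau lam n) (i : Fin (n - 1)) (k : Fin n) :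
    content (tabSwap t i) k = content t (simpleTransp i k) := by
  simp [content, tabSwap, simpleTransp]

lemma tabSwap_tabSwap (t : Tableau lam n) (i : Fin (n - 1)) : tabSwap (tabSwap t i) i = t := by
  ext x; simp [tabSwap, simpleTransp]

lemma content_conjTab (h : lam.transpose = mu) (t : Tableau lam n) (k : Fin n) :
    content (conjTab h t) k = -content t k := by
  simp [content, conjTab, cellSwap]

/-- Two cells cannot have a third one between them if their entries are consecutive. -/
lemma axialDist_of_not_standard {t : Tableau lam n} (ht : IsStandard t) {i : Fin (n - 1)}
    (hs : ¬ IsStandard (tabSwap t i)) : (axialDist t i).natAbs = 1 := by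
  unfold IsStandard at hs
  push Not at hs
  obtain ⟨x, y, hxy, h1, h2, h3⟩ := hs
  have hlt := ht x y hxy h1 h2
  have hx : t x = lo i ∧ t y = hi i := by
    simp only [tabSwap, simpleTransp, Equiv.trans_apply] at h3
    rw [Equiv.swap_apply_def, Equiv.swap_apply_def] at h3
    simp only [lo, hi, Fin.ext_iff, Fin.lt_def, Fin.le_def] at h3 hlt ⊢
    split_ifs at h3 <;> simp_all <;> omega
  obtain ⟨hx, hy⟩ := hx
  have hbetw : ∀ z : lam.cells, z ≠ x → z ≠ y → x.1.1 ≤ z.1.1 → x.1.2 ≤ z.1.2 →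
      z.1.1 ≤ y.1.1 → z.1.2 ≤ y.1.2 → False := by
    intro z hzx hzy a b c d
    have h4 := ht x z (Ne.symm hzx) a b
    have h5 := ht z y hzy c d
    rw [hx] at h4
    rw [hy] at h5
    simp only [lo, hi, Fin.lt_def] at h4 h5
    omega
  have e1 : t.symm (lo i) = x := by rw [← hx]; simp
  have e2 : t.symm (hi i) = y := by rw [← hy]; simp
  rw [axialDist, content, content, e1, e2]
  obtain ⟨⟨r, c⟩, hxm⟩ := x
  obtain ⟨⟨r', c'⟩, hym⟩ := y
  simp only [ne_eq, Subtype.mk.injEq, Prod.mk.injEq] at *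
  have hmem : ∀ a b, a ≤ r' → b ≤ c' → (a, b) ∈ lam.cells := fun a b ha hb =>
    lam.up_left_mem ha hb hym
  by_cases hr : r = r'
  · subst hr
    by_cases hc : c' = c + 1
    · subst hc; push_cast; omega
    · exact (hbetw ⟨(r, c + 1), hmem _ _ le_rfl (by omega)⟩ (by simp)
        (by simp; omega) (by simp) (by simp) (by simp) (by simp; omega)).elim
  · by_cases hc : c = c'
    · subst hc
      by_cases hr' : r' = r + 1
      · subst hr'; push_cast; omega
      · exact (hbetw ⟨(r + 1, c), hmem _ _ (by omega) le_rfl⟩ (by simp)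
          (by simp; omega) (by simp) (by simp) (by simp; omega) (by simp)).elim
    · exact (hbetw ⟨(r, c'), hmem _ _ (by omega) le_rfl⟩ (by simp; omega)
        (by simp; omega) (by simp) (by simp; omega) (by simp; omega) (by simp)).elim

/-- Entries of the same content differ by at least three. -/
lemma content_ne {t : Tableau lam n} (ht : IsStandard t) {k l : Fin n} (hkl : (k : ℕ) < l)
    (hl : (l : ℕ) ≤ k + 2) : content t k ≠ content t l := by
  intro h
  obtain ⟨x, rfl⟩ := t.surjective k
  obtain ⟨y, rfl⟩ := t.surjective l
  simp only [content, Equiv.symm_apply_apply] at h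
  have hxy : x ≠ y := by rintro rfl; exact lt_irrefl _ hkl
  obtain ⟨⟨r, c⟩, hxm⟩ := x
  obtain ⟨⟨r', c'⟩, hym⟩ := y
  simp only at h
  rcases le_or_gt r' r with hr | hr
  · have := ht _ _ hxy.symm (by simpa using hr) (by simp; omega)
    rw [Fin.lt_def] at this
    omega
  · have m1 : (r, c') ∈ lam.cells := lam.up_left_mem hr.le le_rfl hym
    have m2 : (r', c) ∈ lam.cells := lam.up_left_mem le_rfl (by omega) hym
    have a1 := ht ⟨(r, c), hxm⟩ ⟨(r, c'), m1⟩ (by simp; omega) (by simp) (by simp; omega)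
    have a2 := ht ⟨(r, c'), m1⟩ ⟨(r', c'), hym⟩ (by simp; omega) (by simp; omega) (by simp)
    have b1 := ht ⟨(r, c), hxm⟩ ⟨(r', c), m2⟩ (by simp; omega) (by simp; omega) (by simp)
    have b2 := ht ⟨(r', c), m2⟩ ⟨(r', c'), hym⟩ (by simp; omega) (by simp) (by simp; omega)
    rw [Fin.lt_def] at a1 a2 b1 b2
    have : t ⟨(r, c'), m1⟩ = t ⟨(r', c), m2⟩ := by apply Fin.ext; omega
    have := t.injective this
    simp at this
    omega

lemma content_sub_lt (t : Tableau lam n) (k l : Fin n) : content t k - content t l < n := by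
  have hcard : lam.cells.card = n := by simpa using Fintype.card_congr t
  obtain ⟨x, rfl⟩ := t.surjective k
  obtain ⟨y, rfl⟩ := t.surjective l
  simp only [content, Equiv.symm_apply_apply]
  obtain ⟨⟨r, c⟩, hx⟩ := x
  obtain ⟨⟨r', c'⟩, hy⟩ := y
  have hsub : (Finset.range (c + 1)).image (fun j => (0, j)) ∪
      (Finset.range r').image (fun j => (j + 1, 0)) ⊆ lam.cells := by
    intro z hz
    simp only [Finset.mem_union, Finset.mem_image, Finset.mem_range] at hz
    rcases hz with ⟨j, hj, rfl⟩ | ⟨j, hj, rfl⟩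
    · exact lam.up_left_mem (Nat.zero_le _) (by omega) hx
    · exact lam.up_left_mem (by omega) (Nat.zero_le _) hy
  have hle := Finset.card_le_card hsub
  rw [Finset.card_union_of_disjoint, Finset.card_image_of_injective, Finset.card_image_of_injective,
    Finset.card_range, Finset.card_range, hcard] at hle
  · change (c : ℤ) - (r : ℤ) - ((c' : ℤ) - (r' : ℤ)) < n
    omega
  · intro a b hab; simpa using hab
  · intro a b hab; simpa using hab
  · rw [Finset.disjoint_left]
    intro z hz hz'
    simp only [Finset.mem_image] at hz hz'
    obtain ⟨a, _, rfl⟩ := hz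
    obtain ⟨b, _, hb⟩ := hz'
    simp at hb

lemma natAbs_content_sub_lt (t : Tableau lam n) (k l : Fin n) :
    (content t k - content t l).natAbs < n := by
  have h1 := content_sub_lt t k l
  have h2 := content_sub_lt t l k
  omega

/-! ### The Specht module in seminormal form -/

/-- The vector space with basis `v_t`, for `t` a standard `lam`-tableau. -/
abbrev Specht (F : Type*) [Field F] (lam : YoungDiagram) (n : ℕ) : Type _ := StdTableau lam n →₀ F

/-- The basis vector `v_t`. -/
def vec (F : Type*) [Field F] (t : StdTableau lam n) : Specht F lam n := Finsupp.single t 1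

open Classical in
/-- The operator `v_t ↦ -1/[ρ_t(i)] v_t + α_t(i) v_{t s_i}` by which `T_i` acts, where `α_t(i)` is
`α_{ρ_t(i)}` if `t s_i` is standard, and zero otherwise. -/
def spechtOp (S : SquareRoots q n) (lam : YoungDiagram) (i : Fin (n - 1)) :
    Specht F lam n →ₗ[F] Specht F lam n :=
  Finsupp.linearCombination F fun t : StdTableau lam n =>
    (-1 / qInt q (axialDist t.1 i)) • vec F t +
      if h : IsStandard (tabSwap t.1 i) then alpha S (axialDist t.1 i) • vec F ⟨tabSwap t.1 i, h⟩
      else 0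

/-- The same operator on the space with all tableaux as a basis. -/
def genOp (S : SquareRoots q n) (lam : YoungDiagram) (i : Fin (n - 1)) :
    (Tableau lam n →₀ F) →ₗ[F] (Tableau lam n →₀ F) :=
  Finsupp.linearCombination F fun t : Tableau lam n =>
    (-1 / qInt q (axialDist t i)) • Finsupp.single t 1 +
      alpha S (axialDist t i) • Finsupp.single (tabSwap t i) 1

/-- The inclusion of the Specht module in the space spanned by all tableaux. -/
def incl (F : Type*) [Field F] (lam : YoungDiagram) (n : ℕ) :
    Specht F lam n →ₗ[F] (Tableau lam n →₀ F) :=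
  Finsupp.lmapDomain F F Subtype.val

lemma incl_injective : Function.Injective (incl F lam n) :=
  Finsupp.mapDomain_injective Subtype.val_injective

lemma incl_vec (t : StdTableau lam n) : incl F lam n (vec F t) = Finsupp.single t.1 1 := by
  simp [incl, vec]

lemma specht_ext {M : Type*} [AddCommMonoid M] [Module F M] {f g : Specht F lam n →ₗ[F] M}
    (h : ∀ t, f (vec F t) = g (vec F t)) : f = g := by
  apply Finsupp.lhom_ext'
  intro t
  apply LinearMap.ext_ring
  exact h t

lemma spechtOp_vec (S : SquareRoots q n) (i : Fin (n - 1)) (t : StdTableau lam n) :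
    spechtOp S lam i (vec F t) = (-1 / qInt q (axialDist t.1 i)) • vec F t +
      open Classical in
      if h : IsStandard (tabSwap t.1 i) then alpha S (axialDist t.1 i) • vec F ⟨tabSwap t.1 i, h⟩
      else 0 := by
  simp [spechtOp, vec]

lemma genOp_single (S : SquareRoots q n) (i : Fin (n - 1)) (t : Tableau lam n) :
    genOp S lam i (Finsupp.single t 1) =
      (-1 / qInt q (axialDist t i)) • Finsupp.single t 1 +
        alpha S (axialDist t i) • Finsupp.single (tabSwap t i) 1 := by
  simp [genOp]

lemma incl_spechtOp (S : SquareRoots q n) (i : Fin (n - 1)) (v : Specht F lam n) :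
    incl F lam n (spechtOp S lam i v) = genOp S lam i (incl F lam n v) := by
  suffices h : incl F lam n ∘ₗ spechtOp S lam i = genOp S lam i ∘ₗ incl F lam n from
    DFunLike.congr_fun h v
  apply specht_ext
  intro t
  simp only [LinearMap.comp_apply, spechtOp_vec, incl_vec, genOp_single, map_add, map_smul]
  congr 1
  split_ifs with h
  · rw [map_smul, incl_vec]
  · rw [map_zero, alpha_of_natAbs_eq_one S (axialDist_of_not_standard t.2 h), zero_smul]

lemma spechtOp_quad (S : SquareRoots q n) (i : Fin (n - 1)) (v : Specht F lam n) :
    spechtOp S lam i (spechtOp S lam i v) = ((q : F) - (q : F)⁻¹) • spechtOp S lam i v + v := by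
  suffices h : spechtOp S lam i ∘ₗ spechtOp S lam i =
      ((q : F) - (q : F)⁻¹) • spechtOp S lam i + LinearMap.id from DFunLike.congr_fun h v
  apply specht_ext
  intro t
  apply incl_injective
  simp only [LinearMap.comp_apply, LinearMap.add_apply, LinearMap.smul_apply, LinearMap.id_apply,
    map_add, map_smul, incl_spechtOp, incl_vec, genOp_single, tabSwap_tabSwap]
  have hd : axialDist (tabSwap t.1 i) i = -axialDist t.1 i := by
    simp [axialDist, content_tabSwap, simpleTransp]
  have h0 : axialDist t.1 i ≠ 0 :=
    sub_ne_zero.mpr (content_ne t.2 (by simp [lo, hi]) (by simp [lo, hi]))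
  have hn : (axialDist t.1 i).natAbs < n := natAbs_content_sub_lt _ _ _
  have hP := alpha_mul_alpha_neg S h0 hn
  have hu := qInt_ne_zero S h0 hn.le
  have hX := zpow_ne_zero (2 * axialDist t.1 i) q.ne_zero
  have hneg := qInt_neg q (axialDist t.1 i)
  have hm := qInt_mul q (axialDist t.1 i)
  rw [hd]
  generalize axialDist t.1 i = x at *
  have hn2 : qInt q (-x) = -qInt q x / (q : F) ^ (2 * x) := by
    rw [eq_div_iff hX, mul_comm, hneg]
  rw [hn2]
  generalize hz : (q : F) - (q : F)⁻¹ = z at *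
  rw [← hm] at hP hX ⊢
  match_scalars
  · rw [mul_one, mul_one, hP]
    field_simp
    ring
  · field_simp
    ring

lemma spechtOp_comm (S : SquareRoots q n) (i j : Fin (n - 1)) (hij : (i : ℕ) + 1 < j)
    (v : Specht F lam n) :
    spechtOp S lam i (spechtOp S lam j v) = spechtOp S lam j (spechtOp S lam i v) := by
  suffices h : spechtOp S lam i ∘ₗ spechtOp S lam j = spechtOp S lam j ∘ₗ spechtOp S lam i from
    DFunLike.congr_fun h v
  apply specht_ext
  intro t
  apply incl_injective
  have n1 : lo j ≠ lo i := by simp only [lo, ne_eq, Fin.mk.injEq]; omega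
  have n2 : lo j ≠ hi i := by simp only [lo, hi, ne_eq, Fin.mk.injEq]; omega
  have n3 : hi j ≠ lo i := by simp only [lo, hi, ne_eq, Fin.mk.injEq]; omega
  have n4 : hi j ≠ hi i := by simp only [hi, ne_eq, Fin.mk.injEq]; omega
  have d1 : axialDist (tabSwap t.1 i) j = axialDist t.1 j := by
    simp [axialDist, content_tabSwap, simpleTransp, Equiv.swap_apply_of_ne_of_ne, n1, n2, n3, n4]
  have d2 : axialDist (tabSwap t.1 j) i = axialDist t.1 i := by
    simp [axialDist, content_tabSwap, simpleTransp, Equiv.swap_apply_of_ne_of_ne, n1.symm,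
      n2.symm, n3.symm, n4.symm]
  have e : tabSwap (tabSwap t.1 i) j = tabSwap (tabSwap t.1 j) i := by
    apply Equiv.ext
    intro x
    have si1 : simpleTransp i (lo i) = hi i := Equiv.swap_apply_left _ _
    have si2 : simpleTransp i (hi i) = lo i := Equiv.swap_apply_right _ _
    have sj1 : simpleTransp j (lo j) = hi j := Equiv.swap_apply_left _ _
    have sj2 : simpleTransp j (hi j) = lo j := Equiv.swap_apply_right _ _
    have a1 : simpleTransp i (lo j) = lo j := Equiv.swap_apply_of_ne_of_ne n1 n2
    have a2 : simpleTransp i (hi j) = hi j := Equiv.swap_apply_of_ne_of_ne n3 n4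
    have b1 : simpleTransp j (lo i) = lo i := Equiv.swap_apply_of_ne_of_ne n1.symm n3.symm
    have b2 : simpleTransp j (hi i) = hi i := Equiv.swap_apply_of_ne_of_ne n2.symm n4.symm
    simp only [tabSwap, Equiv.trans_apply]
    by_cases h1 : t.1 x = lo i
    · rw [h1, si1, b1, b2, si1]
    by_cases h2 : t.1 x = hi i
    · rw [h2, si2, b1, b2, si2]
    by_cases h3 : t.1 x = lo j
    · rw [h3, sj1, a1, a2, sj1]
    by_cases h4 : t.1 x = hi j
    · rw [h4, sj2, a1, a2, sj2]
    have c1 : simpleTransp i (t.1 x) = t.1 x := Equiv.swap_apply_of_ne_of_ne h1 h2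
    have c2 : simpleTransp j (t.1 x) = t.1 x := Equiv.swap_apply_of_ne_of_ne h3 h4
    rw [c1, c2, c1]
  simp only [LinearMap.comp_apply, map_add, map_smul, incl_spechtOp, incl_vec, genOp_single,
    d1, d2, e]
  module

lemma seminormal_one {u v w X : F} (hu : u ≠ 0) (hv : v ≠ 0) (hw : w ≠ 0)
    (h : w = u + X * v) :
    -1 / u * (-1 / v) + -1 / w * (-1 / (-u / X)) = -1 / v * (-1 / w) := by
  field_simp
  linear_combination h

lemma seminormal_two {u v w X Y z : F} (hu : u ≠ 0) (hv : v ≠ 0) (hw : w ≠ 0)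
    (hX : X = 1 + z * u) (hY : Y = 1 + z * v) (h : w = u + X * v) :
    -1 / u * (-1 / v) * (-1 / u) + (1 - X / u ^ 2) * (-1 / w) =
      -1 / v * (-1 / u) * (-1 / v) + (1 - Y / v ^ 2) * (-1 / w) := by
  field_simp
  rw [h, hX, hY]
  ring

lemma spechtOp_braid (S : SquareRoots q n) (i j : Fin (n - 1)) (hij : (j : ℕ) = i + 1)
    (v : Specht F lam n) :
    spechtOp S lam i (spechtOp S lam j (spechtOp S lam i v)) =
      spechtOp S lam j (spechtOp S lam i (spechtOp S lam j v)) := by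
  suffices h : spechtOp S lam i ∘ₗ spechtOp S lam j ∘ₗ spechtOp S lam i =
      spechtOp S lam j ∘ₗ spechtOp S lam i ∘ₗ spechtOp S lam j from DFunLike.congr_fun h v
  apply specht_ext
  intro t
  apply incl_injective
  have hm : lo j = hi i := by simp only [lo, hi, Fin.mk.injEq]; omega
  have n1 : lo i ≠ hi i := lo_ne_hi i
  have n2 : hi i ≠ hi j := by rw [← hm]; exact lo_ne_hi j
  have n3 : lo i ≠ hi j := by simp only [lo, hi, ne_eq, Fin.mk.injEq]; omega
  have si1 : simpleTransp i (lo i) = hi i := Equiv.swap_apply_left _ _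
  have si2 : simpleTransp i (hi i) = lo i := Equiv.swap_apply_right _ _
  have si3 : simpleTransp i (hi j) = hi j := Equiv.swap_apply_of_ne_of_ne n3.symm n2.symm
  have sj1 : simpleTransp j (lo i) = lo i :=
    Equiv.swap_apply_of_ne_of_ne (by rw [hm]; exact n1) n3
  have sj2 : simpleTransp j (hi i) = hi j := by
    rw [← hm]; exact Equiv.swap_apply_left _ _
  have sj3 : simpleTransp j (hi j) = hi i := by
    rw [← hm]; exact Equiv.swap_apply_right _ _
  have e : tabSwap (tabSwap (tabSwap t.1 i) j) i = tabSwap (tabSwap (tabSwap t.1 j) i) j := by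
    apply Equiv.ext
    intro x
    simp only [tabSwap, Equiv.trans_apply]
    by_cases h1 : t.1 x = lo i
    · rw [h1, si1, sj2, si3, sj1, si1, sj2]
    by_cases h2 : t.1 x = hi i
    · rw [h2, si2, sj1, si1, sj2, si3, sj3]
    by_cases h3 : t.1 x = hi j
    · rw [h3, si3, sj3, si2, sj1]
    · have a1 : simpleTransp i (t.1 x) = t.1 x := Equiv.swap_apply_of_ne_of_ne h1 h2
      have a2 : simpleTransp j (t.1 x) = t.1 x :=
        Equiv.swap_apply_of_ne_of_ne (by rw [hm]; exact h2) h3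
      rw [a1, a2, a1, a2]
  have ha : content t.1 (lo i) - content t.1 (hi i) ≠ 0 :=
    sub_ne_zero.mpr (content_ne t.2 (by simp [lo, hi]) (by simp [lo, hi]))
  have hb : content t.1 (hi i) - content t.1 (hi j) ≠ 0 :=
    sub_ne_zero.mpr (content_ne t.2 (by simp [hi]; omega) (by simp [hi]; omega))
  have hc : content t.1 (lo i) - content t.1 (hi j) ≠ 0 :=
    sub_ne_zero.mpr (content_ne t.2 (by simp [lo, hi]; omega) (by simp [lo, hi]; omega))
  have ha' := natAbs_content_sub_lt t.1 (lo i) (hi i)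
  have hb' := natAbs_content_sub_lt t.1 (hi i) (hi j)
  have hc' := natAbs_content_sub_lt t.1 (lo i) (hi j)
  simp only [LinearMap.comp_apply, map_add, map_smul, incl_spechtOp, incl_vec, genOp_single, e,
    tabSwap_tabSwap, axialDist, content_tabSwap, si1, si2, si3, sj1, sj2, sj3, hm]
  generalize content t.1 (lo i) = a at *
  generalize content t.1 (hi i) = b at *
  generalize content t.1 (hi j) = c at *
  rw [← neg_sub a b, ← neg_sub b c]
  have hw : a - c = (a - b) + (b - c) := by ring
  have hadd := qInt_add q (a - b) (b - c)
  have hadd' := qInt_add q (b - c) (a - b)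
  rw [← hw] at hadd
  rw [show b - c + (a - b) = a - c by ring] at hadd'
  have hP := alpha_mul_alpha_neg S ha ha'
  have hQ := alpha_mul_alpha_neg S hb hb'
  have hu := qInt_ne_zero S ha ha'.le
  have hv := qInt_ne_zero S hb hb'.le
  have hw0 := qInt_ne_zero S hc hc'.le
  have hX := zpow_ne_zero (2 * (a - b)) q.ne_zero
  have hY := zpow_ne_zero (2 * (b - c)) q.ne_zero
  have hn1 : qInt q (-(a - b)) = -qInt q (a - b) / (q : F) ^ (2 * (a - b)) := by
    rw [eq_div_iff hX, mul_comm, qInt_neg]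
  have hn2 : qInt q (-(b - c)) = -qInt q (b - c) / (q : F) ^ (2 * (b - c)) := by
    rw [eq_div_iff hY, mul_comm, qInt_neg]
  have i0 := seminormal_two hu hv hw0 (qInt_mul q (a - b)).symm (qInt_mul q (b - c)).symm hadd
  have i1 := seminormal_one hu hv hw0 hadd
  have i2 := seminormal_one hv hu hw0 hadd'
  rw [← hn1] at i1
  rw [← hn2] at i2
  rw [← hP, ← hQ] at i0
  linear_combination (norm := module) i0 • (Finsupp.single t.1 1 : Tableau lam n →₀ F) +
    (alpha S (a - b) * i1) • (Finsupp.single (tabSwap t.1 i) 1 : Tableau lam n →₀ F) -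
    (alpha S (b - c) * i2) • (Finsupp.single (tabSwap t.1 j) 1 : Tableau lam n →₀ F)

/-- The Specht module `S(lam)` as a right module over the Hecke algebra: `h` acts on the right by
the operator `(spechtRep S lam h).unop`. -/
def spechtRep (S : SquareRoots q n) (lam : YoungDiagram) :
    Hecke q n →ₐ[F] (Module.End F (Specht F lam n))ᵐᵒᵖ :=
  heckeLift q n (fun i => MulOpposite.op (spechtOp S lam i))
    (by
      intro i
      apply MulOpposite.unop_injective
      apply LinearMap.ext
      intro v
      have hq : (q : F) * (q : F)⁻¹ = 1 := mul_inv_cancel₀ q.ne_zero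
      have h := spechtOp_quad S i v
      simp only [MulOpposite.unop_mul, MulOpposite.unop_sub, MulOpposite.unop_add,
        MulOpposite.algebraMap_apply, MulOpposite.unop_op, MulOpposite.unop_zero,
        Module.End.mul_apply, LinearMap.sub_apply, LinearMap.add_apply,
        Module.algebraMap_end_apply, map_sub, map_smul, h, LinearMap.zero_apply]
      match_scalars
      · ring
      · linear_combination -hq)
    (by
      intro i j h
      apply MulOpposite.unop_injective
      apply LinearMap.ext
      intro v
      exact (spechtOp_comm S i j h v).symm)
    (by
      intro i j h
      apply MulOpposite.unop_injective
      apply LinearMap.ext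
      intro v
      exact spechtOp_braid S i j h v)

/-- Right multiplication by `h` on the Specht module. -/
def spechtAct (S : SquareRoots q n) (lam : YoungDiagram) (h : Hecke q n) :
    Specht F lam n →ₗ[F] Specht F lam n :=
  (spechtRep S lam h).unop

/-- The linear map `τ : S(lam) → S(lam')` with `v_t ↦ v_{t'}`. -/
def tau (F : Type*) [Field F] (n : ℕ) (h : lam.transpose = mu) :
    Specht F lam n →ₗ[F] Specht F mu n :=
  Finsupp.lmapDomain F F (conjStd h)

/-- The character `χ^lam` of the Specht module. -/
def spechtChar (S : SquareRoots q n) (lam : YoungDiagram) (h : Hecke q n) : F :=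
  LinearMap.trace F (Specht F lam n) (spechtAct S lam h)

/-- `χ^lam(hτ)`: for `lam = lam'`, the trace of the endomorphism of `S(lam)` obtained by composing
right multiplication by `h` with `τ`. -/
def spechtTauChar (S : SquareRoots q n) (hlam : lam.transpose = lam) (h : Hecke q n) : F :=
  LinearMap.trace F (Specht F lam n) (spechtAct S lam h ∘ₗ tau F n hlam)

/-! ### The two halves of the Specht module of a self-conjugate partition -/

/-- The number `2` lies in the first row of `t`. -/
def TwoInFirstRow (t : StdTableau lam n) : Prop :=
  ∃ x : lam.cells, (t.1 x : ℕ) = 1 ∧ x.1.1 = 0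

/-- `S(lam)^ε`, for a sign `ε`: the span of all `v_t + ε v_{t'}`, where `t` runs over the standard
tableaux with `2` in the first row. -/
def spechtHalf (F : Type*) [Field F] (n : ℕ) (hlam : lam.transpose = lam) (ε : ℤˣ) :
    Submodule F (Specht F lam n) :=
  Submodule.span F {v | ∃ t : StdTableau lam n, TwoInFirstRow t ∧
    v = vec F t + ((ε : ℤ) : F) • vec F (conjStd hlam t)}

lemma tau_vec (h : lam.transpose = mu) (t : StdTableau lam n) :
    tau F n h (vec F t) = vec F (conjStd h t) := by
  simp [tau, vec]

lemma conjStd_conjStd (h : lam.transpose = lam) (t : StdTableau lam n) :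
    conjStd h (conjStd h t) = t := by
  apply Subtype.ext
  apply Equiv.ext
  intro x
  simp [conjStd, conjTab, cellSwap]

lemma conjTab_tabSwap (h : lam.transpose = lam) (t : Tableau lam n) (i : Fin (n - 1)) :
    conjTab h (tabSwap t i) = tabSwap (conjTab h t) i := rfl

/-- `τ` intertwines the action of `h` and that of `h^#`. -/
lemma tau_spechtAct (S : SquareRoots q n) (hlam : lam.transpose = lam) (h : Hecke q n) :
    ∀ v, tau F n hlam (spechtAct S lam h v) = spechtAct S lam (hash q n h) (tau F n hlam v) := by
  induction h using hecke_induction with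
  | hscalar c =>
    intro v
    simp [spechtAct, MulOpposite.algebraMap_apply, Module.algebraMap_end_apply]
  | hadd x y hx hy => intro v; simp_all [spechtAct]
  | hmul x y hx hy => intro v; simp_all [spechtAct]
  | hgen i =>
    suffices h : tau F n hlam ∘ₗ spechtAct S lam (heckeGen q n i) =
        spechtAct S lam (hash q n (heckeGen q n i)) ∘ₗ tau F n hlam from DFunLike.congr_fun h
    apply specht_ext
    intro t
    have g1 : spechtAct S lam (heckeGen q n i) = spechtOp S lam i := by
      simp [spechtAct, spechtRep]
    have g2 : ∀ v, spechtAct S lam (hash q n (heckeGen q n i)) v =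
        -spechtOp S lam i v + ((q : F) - (q : F)⁻¹) • v := by
      intro v
      rw [hash_gen, heckeGenInv, ← g1]
      simp only [spechtAct, map_neg, map_sub, AlgHom.commutes, MulOpposite.algebraMap_apply,
        MulOpposite.unop_neg, MulOpposite.unop_sub, MulOpposite.unop_op, LinearMap.neg_apply,
        LinearMap.sub_apply, Module.algebraMap_end_apply]
      module
    rw [LinearMap.comp_apply, LinearMap.comp_apply, g1, g2, tau_vec, spechtOp_vec, spechtOp_vec,
      map_add, map_smul, tau_vec]
    have hd : axialDist (conjStd hlam t).1 i = -axialDist t.1 i := by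
      simp only [axialDist, conjStd, content_conjTab]; ring
    have hstd : IsStandard (tabSwap (conjStd hlam t).1 i) ↔ IsStandard (tabSwap t.1 i) := by
      constructor
      · intro h'
        have := h'.conj hlam
        rw [conjTab_tabSwap] at this
        have e := congrArg Subtype.val (conjStd_conjStd hlam t)
        change conjTab hlam (conjStd hlam t).1 = t.1 at e
        rwa [e] at this
      · exact fun h' => h'.conj hlam
    have h0 : axialDist t.1 i ≠ 0 :=
      sub_ne_zero.mpr (content_ne t.2 (by simp [lo, hi]) (by simp [lo, hi]))
    have hn : (axialDist t.1 i).natAbs < n := natAbs_content_sub_lt _ _ _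
    have hu := qInt_ne_zero S h0 hn.le
    have hX := zpow_ne_zero (2 * axialDist t.1 i) q.ne_zero
    have hm := qInt_mul q (axialDist t.1 i)
    have hn2 : qInt q (-axialDist t.1 i) =
        -qInt q (axialDist t.1 i) / (q : F) ^ (2 * axialDist t.1 i) := by
      rw [eq_div_iff hX, mul_comm, qInt_neg]
    have hcoef : -1 / qInt q (axialDist t.1 i) =
        1 / qInt q (-axialDist t.1 i) + ((q : F) - (q : F)⁻¹) := by
      rw [hn2, ← hm]
      rw [← hm] at hX
      field_simp
      ring
    rw [hd, alpha_neg, hcoef]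
    by_cases hs : IsStandard (tabSwap t.1 i)
    · have hs' := hstd.mpr hs
      rw [dif_pos hs, dif_pos hs', map_smul, tau_vec]
      have : conjStd hlam ⟨tabSwap t.1 i, hs⟩ = ⟨tabSwap (conjStd hlam t).1 i, hs'⟩ := rfl
      rw [this]
      module
    · rw [dif_neg hs, dif_neg (fun h' => hs (hstd.mp h')), map_zero]
      module

lemma twoInFirstRow_or (hlam : lam.transpose = lam) (hn : 2 ≤ n) (t : StdTableau lam n) :
    TwoInFirstRow t ∨ TwoInFirstRow (conjStd hlam t) := by
  obtain ⟨x, hx⟩ := t.1.surjective ⟨1, by omega⟩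
  by_cases h1 : x.1.1 = 0
  · exact Or.inl ⟨x, by rw [hx], h1⟩
  by_cases h2 : x.1.2 = 0
  · refine Or.inr ⟨(cellSwap hlam).symm x, ?_, h2⟩
    simp [conjStd, conjTab, hx]
  exfalso
  obtain ⟨⟨r, c⟩, hm⟩ := x
  simp only at h1 h2
  have m1 : (0, c) ∈ lam.cells := lam.up_left_mem (Nat.zero_le _) le_rfl hm
  have m2 : (0, 0) ∈ lam.cells := lam.up_left_mem (Nat.zero_le _) (Nat.zero_le _) hm
  have a1 := t.2 ⟨(0, 0), m2⟩ ⟨(0, c), m1⟩ (by simp; omega) (by simp) (by simp)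
  have a2 := t.2 ⟨(0, c), m1⟩ ⟨(r, c), hm⟩ (by simp; omega) (by simp) (by simp)
  rw [hx, Fin.lt_def] at a2
  rw [Fin.lt_def] at a1
  simp only at a2
  omega

lemma add_tau_mem_spechtHalf (hlam : lam.transpose = lam) (hn : 2 ≤ n) (ε : ℤˣ)
    (v : Specht F lam n) : v + ((ε : ℤ) : F) • tau F n hlam v ∈ spechtHalf F n hlam ε := by
  have hv : v ∈ Submodule.span F (Set.range (vec F (lam := lam) (n := n))) := by
    have : vec F (lam := lam) (n := n) = Finsupp.basisSingleOne (R := F) := by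
      funext t; simp [vec]
    rw [this, Module.Basis.span_eq]
    trivial
  induction hv using Submodule.span_induction with
  | mem x hx =>
    obtain ⟨t, rfl⟩ := hx
    rw [tau_vec]
    rcases twoInFirstRow_or hlam hn t with h | h
    · exact Submodule.subset_span ⟨t, h, rfl⟩
    · have hmem : vec F (conjStd hlam t) + ((ε : ℤ) : F) • vec F (conjStd hlam (conjStd hlam t)) ∈
          spechtHalf F n hlam ε := Submodule.subset_span ⟨_, h, rfl⟩
      rw [conjStd_conjStd] at hmem
      have := Submodule.smul_mem _ ((ε : ℤ) : F) hmem
      convert this using 1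
      have hε : ((ε : ℤ) : F) * ((ε : ℤ) : F) = 1 := by
        rcases Int.units_eq_one_or ε with rfl | rfl <;> simp
      rw [smul_add, smul_smul, hε, one_smul, add_comm]
  | zero => simp
  | add x y _ _ hx hy =>
    have := Submodule.add_mem _ hx hy
    convert this using 1
    rw [map_add]
    module
  | smul a x _ hx =>
    have := Submodule.smul_mem _ a hx
    convert this using 1
    rw [map_smul]
    module

/-- `S(lam)^ε` is stable under the alternating Hecke algebra. -/
lemma spechtAct_mem_spechtHalf (S : SquareRoots q n) (hlam : lam.transpose = lam) (ε : ℤˣ)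
    (a : altHecke q n) : ∀ v ∈ spechtHalf F n hlam ε,
      spechtAct S lam (a : Hecke q n) v ∈ spechtHalf F n hlam ε := by
  intro v hv
  induction hv using Submodule.span_induction with
  | mem x hx =>
    obtain ⟨t, ht, rfl⟩ := hx
    have hn : 2 ≤ n := by
      obtain ⟨x, hx, _⟩ := ht
      have := (t.1 x).2
      omega
    have h := tau_spechtAct S hlam (a : Hecke q n) (vec F t)
    rw [mem_altHecke.mp a.2] at h
    rw [map_add, map_smul, ← tau_vec, ← h]
    exact add_tau_mem_spechtHalf hlam hn ε _
  | zero => simp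
  | add x y _ _ hx hy => rw [map_add]; exact Submodule.add_mem _ hx hy
  | smul c x _ hx => rw [map_smul]; exact Submodule.smul_mem _ c hx

/-- `S(lam)^ε` as a right module over the alternating Hecke algebra, by restricting the action of
the Hecke algebra on `S(lam)`. -/
def halfRep (S : SquareRoots q n) (hlam : lam.transpose = lam) (ε : ℤˣ) :
    altHecke q n →ₐ[F] (Module.End F (spechtHalf F n hlam ε))ᵐᵒᵖ where
  toFun a := MulOpposite.op
    ((spechtAct S lam (a : Hecke q n)).restrict (spechtAct_mem_spechtHalf S hlam ε a))
  map_one' := by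
    apply MulOpposite.unop_injective
    ext v
    simp [spechtAct]
  map_mul' a b := by
    apply MulOpposite.unop_injective
    ext v
    simp [spechtAct]
  map_zero' := by
    apply MulOpposite.unop_injective
    ext v
    simp [spechtAct]
  map_add' a b := by
    apply MulOpposite.unop_injective
    ext v
    simp [spechtAct]
  commutes' c := by
    apply MulOpposite.unop_injective
    ext v
    simp [spechtAct, MulOpposite.algebraMap_apply, Module.algebraMap_end_apply]

/-- The character `χ_A^{lam ε}` of the module `S(lam)^ε` over the alternating Hecke algebra. -/
def halfChar (S : SquareRoots q n) (hlam : lam.transpose = lam) (ε : ℤˣ) (a : altHecke q n) : F :=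
  LinearMap.trace F (spechtHalf F n hlam ε) (halfRep S hlam ε a).unop

end

end AltHecke

/-! The map `τ` is an involution intertwining the actions of `h` and `h^#`, so it commutes with the
alternating Hecke algebra, and `S(lam)^ε` is its `ε`-eigenspace. The trace of `a` on this eigenspace
is the trace on `S(lam)` of `a` composed with the projection `½ (1 + ε τ)`, which gives the first
formula. For the second, conjugation by `τ` shows that `h` and `h^#` have the same trace after
composition with any operator commuting with `τ`, such as this projection; hence `A_w`, the average
of `T_w` and `T_w^#`, may be replaced by `T_w`. -/

namespace AltHecke

section EigenProj

variable {R M : Type*} [CommRing R] [AddCommGroup M] [Module R M]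

/-- The projection `½ (1 + ε σ)` onto the `ε`-eigenspace of an involution `σ`, for a sign `ε`; that
`σ` and `ε` square to `1` is left to the lemma `isProj_eigenProj`. -/
def eigenProj [Invertible (2 : R)] (σ : Module.End R M) (ε : R) : Module.End R M :=
  (⅟2 : R) • (1 + ε • σ)

lemma eigenProj_apply [Invertible (2 : R)] (σ : Module.End R M) (ε : R) (v : M) :
    eigenProj σ ε v = (⅟2 : R) • (v + ε • σ v) := rfl

lemma isProj_eigenProj [Invertible (2 : R)] {σ : Module.End R M} (hσ : σ * σ = 1) {ε : R}
    (hε : ε * ε = 1) : LinearMap.IsProj (σ.eigenspace ε) (eigenProj σ ε) where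
  map_mem v := by
    have hσv : σ (σ v) = v := LinearMap.congr_fun hσ v
    rw [Module.End.mem_eigenspace_iff, eigenProj_apply, map_smul, map_add, map_smul, hσv,
      smul_comm ε, smul_add ε, smul_smul ε ε, hε, one_smul, add_comm]
  map_id v hv := by
    rw [eigenProj_apply, Module.End.mem_eigenspace_iff.mp hv, smul_smul, hε, one_smul, ← two_smul R,
      invOf_smul_smul]

lemma commute_eigenProj [Invertible (2 : R)] (σ : Module.End R M) (ε : R) :
    Commute σ (eigenProj σ ε) :=
  ((Commute.one_right σ).add_right ((Commute.refl σ).smul_right ε)).smul_right _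

lemma trace_restrict_eq_trace_mul_of_isProj [IsDomain R] [IsPrincipalIdealRing R]
    [Module.Free R M] [Module.Finite R M] {p : Submodule R M} {π : Module.End R M}
    (hπ : LinearMap.IsProj p π) (f : Module.End R M) (hf : ∀ v ∈ p, f v ∈ p) :
    LinearMap.trace R p (f.restrict hf) = LinearMap.trace R M (f * π) := by
  have hmem (v : M) : (f * π) v ∈ p := hf _ (hπ.map_mem v)
  have hrestrict : f.restrict hf = (f * π).restrict fun v _ => hmem v := by
    ext v
    simp [hπ.map_id v v.2]
  rw [hrestrict, LinearMap.trace_restrict_eq_of_forall_mem p (f * π) hmem]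

end EigenProj

variable {F : Type*} [Field F] {q : Fˣ} {n : ℕ} {lam : YoungDiagram}

lemma intCast_units_mul_self (R : Type*) [Ring R] (ε : ℤˣ) : ((ε : ℤ) : R) * ((ε : ℤ) : R) = 1 := by
  rw [← Int.cast_mul, Int.units_coe_mul_self, Int.cast_one]

lemma tau_mul_tau (hlam : lam.transpose = lam) : tau F n hlam * tau F n hlam = 1 :=
  specht_ext fun t => by simp [tau_vec, conjStd_conjStd]

lemma spechtHalf_le_eigenspace_tau (hlam : lam.transpose = lam) (ε : ℤˣ) :
    spechtHalf F n hlam ε ≤ Module.End.eigenspace (tau F n hlam) ((ε : ℤ) : F) := by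
  refine Submodule.span_le.mpr ?_
  rintro _ ⟨t, -, rfl⟩
  rw [SetLike.mem_coe, Module.End.mem_eigenspace_iff, map_add, map_smul, tau_vec, tau_vec,
    conjStd_conjStd, smul_add, smul_smul, intCast_units_mul_self, one_smul, add_comm]

lemma trace_spechtAct_hash_mul (S : SquareRoots q n) (hlam : lam.transpose = lam)
    (h : Hecke q n) {g : Module.End F (Specht F lam n)} (hg : Commute (tau F n hlam) g) :
    LinearMap.trace F (Specht F lam n) (spechtAct S lam (hash q n h) * g) =
      LinearMap.trace F (Specht F lam n) (spechtAct S lam h * g) := by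
  set τ : Module.End F (Specht F lam n) := tau F n hlam
  have hττ : τ * τ = 1 := tau_mul_tau hlam
  have hτ : spechtAct S lam (hash q n h) * τ = τ * spechtAct S lam h :=
    LinearMap.ext fun v => (tau_spechtAct S hlam h v).symm
  calc LinearMap.trace F _ (spechtAct S lam (hash q n h) * g)
      = LinearMap.trace F _ (spechtAct S lam (hash q n h) * τ * (τ * g)) := by
        rw [mul_assoc, ← mul_assoc τ, hττ, one_mul]
    _ = LinearMap.trace F _ (τ * (spechtAct S lam h * (g * τ))) := by
        rw [hτ, hg.eq, mul_assoc]
    _ = LinearMap.trace F _ (spechtAct S lam h * g) := by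
        rw [LinearMap.trace_mul_comm, mul_assoc, mul_assoc, hττ, mul_one]

lemma coe_altA (w : alternatingGroup (Fin n)) (e : ReducedExpr (w : Equiv.Perm (Fin n))) :
    (altA q w e : Hecke q n) = (2 : F)⁻¹ • (heckeT q e + hash q n (heckeT q e)) := by
  have hsign : (-1 : ℤˣ) ^ e.word.length = 1 := by
    rw [← sign_word, e.prod_eq, Equiv.Perm.mem_alternatingGroup.mp w.2]
  have hsignF : (-1 : F) ^ e.word.length = 1 := by
    simpa using congrArg (fun u : ℤˣ => ((u : ℤ) : F)) hsign
  change heckeA q e = _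
  rw [heckeA, hsignF, one_smul]

section Invertible

variable [Invertible (2 : F)]

lemma spechtHalf_eq_eigenspace_tau (hn : 2 ≤ n) (hlam : lam.transpose = lam) (ε : ℤˣ) :
    spechtHalf F n hlam ε = Module.End.eigenspace (tau F n hlam) ((ε : ℤ) : F) := by
  refine (spechtHalf_le_eigenspace_tau hlam ε).antisymm fun v hv => ?_
  rw [← (isProj_eigenProj (tau_mul_tau hlam) (intCast_units_mul_self F ε)).map_id v hv,
    eigenProj_apply]
  exact Submodule.smul_mem _ _ (add_tau_mem_spechtHalf hlam hn ε v)

lemma halfChar_eq_trace_mul_eigenProj (hn : 2 ≤ n) (S : SquareRoots q n)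
    (hlam : lam.transpose = lam) (ε : ℤˣ) (a : altHecke q n) :
    halfChar S hlam ε a = LinearMap.trace F (Specht F lam n)
      (spechtAct S lam a * eigenProj (tau F n hlam) ((ε : ℤ) : F)) := by
  have hproj : LinearMap.IsProj (spechtHalf F n hlam ε)
      (eigenProj (tau F n hlam) ((ε : ℤ) : F)) := by
    rw [spechtHalf_eq_eigenspace_tau hn]
    exact isProj_eigenProj (tau_mul_tau hlam) (intCast_units_mul_self F ε)
  exact trace_restrict_eq_trace_mul_of_isProj hproj _ (spechtAct_mem_spechtHalf S hlam ε a)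

lemma trace_spechtAct_mul_eigenProj (S : SquareRoots q n) (hlam : lam.transpose = lam) (ε : F)
    (h : Hecke q n) :
    LinearMap.trace F (Specht F lam n) (spechtAct S lam h * eigenProj (tau F n hlam) ε) =
      (1 / 2 : F) * (spechtChar S lam h + ε * spechtTauChar S hlam h) := by
  rw [eigenProj, mul_smul_comm, mul_add, mul_one, mul_smul_comm, map_smul, map_add, map_smul,
    smul_eq_mul, smul_eq_mul, invOf_eq_inv, one_div]
  rfl

lemma trace_spechtAct_altA_mul (S : SquareRoots q n) (hlam : lam.transpose = lam)
    (w : alternatingGroup (Fin n)) (e : ReducedExpr (w : Equiv.Perm (Fin n)))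
    {g : Module.End F (Specht F lam n)} (hg : Commute (tau F n hlam) g) :
    LinearMap.trace F (Specht F lam n) (spechtAct S lam (altA q w e) * g) =
      LinearMap.trace F (Specht F lam n) (spechtAct S lam (heckeT q e) * g) := by
  have hact : spechtAct S lam (altA q w e) =
      (2 : F)⁻¹ • (spechtAct S lam (heckeT q e) + spechtAct S lam (hash q n (heckeT q e))) := by
    simp [coe_altA, spechtAct]
  rw [hact, smul_mul_assoc, add_mul, map_smul, map_add, trace_spechtAct_hash_mul S hlam _ hg,
    smul_eq_mul, ← two_mul, inv_mul_cancel_left₀ (Invertible.ne_zero (2 : F))]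

end Invertible

end AltHecke

theorem mainTheorem7 {F : Type*} [Field F] (h2 : (2 : F) ≠ 0) (q : Fˣ) (n : ℕ) (hn : 2 ≤ n)
    (S : AltHecke.SquareRoots q n) (lam : YoungDiagram) (hcard : lam.card = n)
    (hlam : lam.transpose = lam) (ε : ℤˣ) :
    (∀ a : AltHecke.altHecke q n,
      AltHecke.halfChar S hlam ε a =
        (1 / 2 : F) * (AltHecke.spechtChar S lam (a : AltHecke.Hecke q n) +
          ((ε : ℤ) : F) * AltHecke.spechtTauChar S hlam (a : AltHecke.Hecke q n))) ∧
    (∀ (w : alternatingGroup (Fin n)) (e : AltHecke.ReducedExpr (w : Equiv.Perm (Fin n))),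
      AltHecke.halfChar S hlam ε (AltHecke.altA q w e) =
        (1 / 2 : F) * (AltHecke.spechtChar S lam (AltHecke.heckeT q e) +
          ((ε : ℤ) : F) * AltHecke.spechtTauChar S hlam (AltHecke.heckeT q e))) := by
  let := invertibleOfNonzero h2
  refine ⟨fun a => ?_, fun w e => ?_⟩
  · rw [AltHecke.halfChar_eq_trace_mul_eigenProj hn, AltHecke.trace_spechtAct_mul_eigenProj]
  · rw [AltHecke.halfChar_eq_trace_mul_eigenProj hn,
      AltHecke.trace_spechtAct_altA_mul S hlam w e (AltHecke.commute_eigenProj _ _),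
      AltHecke.trace_spechtAct_mul_eigenProj]
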